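/- Let $M$ be a smooth $n$-manifold, $\psi=(\psi_1,\dots,\psi_{n+1}):M\to\mathbb R^{n+1}$ a smooth immersion and $\nu$ a smooth unit normal vector field along $\psi$. In local coordinates $x_1,\dots,x_n$ let $g_{ij}=\langle\partial_i\psi,\partial_j\psi\rangle$ be the induced metric, $A_{ij}=\langle\partial_i\partial_j\psi,\nu\rangle$ the second fundamental form and $A=(A^i_j)$, $A^i_j=g^{ik}A_{kj}$, the shape operator; a comma denotes covariant differentiation with respect to the Levi-Civita connection of $g$. Let $\mu_0\in\mathbb R$ be a constant and $r\ge 0$ an integer. With $\sigma_k$ the $k$-th elementary symmetric function of the eigenvalues of $A$ (so $\sigma_0=1$ and $\sigma_k=0$ for $k>n$), put $$\sigma_r^\infty=\sum_{j=0}^{r}\frac{\mu_0^j}{j!}\,\sigma_{r-j},\qquad T_r^\infty=\sum_{j=0}^{r}(-1)^j\sigma_{r-j}^\infty A^j,\qquad (T_r^\infty)^{ij}=(T_r^\infty)^i_k\,g^{kj}.$$ The hypersurface is called $\sigma_r^\infty$-minimal if $(r+1)\sigma_{r+1}^\infty-\mu_0\sigma_r^\infty$ vanishes identically on $M$. Then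 the following are equivalent: 1. the hypersurface is $\sigma_r^\infty$-minimal; 2. every component $\psi_a$ of the position vector satisfies $(T_r^\infty)^{ij}\psi_{a,ij}=0$ on $M$; 3. every component $\psi_a$ satisfies the divergence-form equation $\big((T_r^\infty)^{ij}\psi_{a,i}\big)_{,j}=0$ on $M$. Moreover, the tensor $(T_r^\infty)^{ij}$ is divergence-free: $(T_r^\infty)^{ij}{}_{,j}=0$. -/

import Mathlib

open scoped Manifold ContDiff

noncomputable section

namespace WeightedCurvature

/-! ### Weighted symmetric functions and weighted Newton transformations of a matrix -/

/-- The `k`-th elementary symmetric function `σ_k` of the (real) eigenvalues of `A`,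
listed with algebraic multiplicity. -/
def sigma {n : ℕ} (A : Matrix (Fin n) (Fin n) ℝ) (k : ℕ) : ℝ :=
  A.charpoly.roots.esymm k

/-- The weighted elementary symmetric polynomial
`σ_r^∞(μ₀, A) = ∑_{j=0}^r μ₀^j / j! · σ_{r-j}(A)`. -/
def wsigma {n : ℕ} (μ₀ : ℝ) (A : Matrix (Fin n) (Fin n) ℝ) (r : ℕ) : ℝ :=
  ∑ j ∈ Finset.range (r + 1), μ₀ ^ j / (j.factorial : ℝ) * sigma A (r - j)

/-- The weighted Newton transformation
`T_r^∞(μ₀, A) = ∑_{j=0}^r (-1)^j σ_{r-j}^∞(μ₀, A) A^j`. -/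
def wNewton {n : ℕ} (μ₀ : ℝ) (A : Matrix (Fin n) (Fin n) ℝ) (r : ℕ) :
    Matrix (Fin n) (Fin n) ℝ :=
  ∑ j ∈ Finset.range (r + 1), ((-1) ^ j * wsigma μ₀ A (r - j)) • A ^ j

/-! ### Tensor calculus in a coordinate domain of `ℝⁿ` -/

/-- The partial derivative `∂f/∂x_i` at `u`. -/
def pd {n : ℕ} {F : Type*} [NormedAddCommGroup F] [NormedSpace ℝ F]
    (i : Fin n) (f : EuclideanSpace ℝ (Fin n) → F) (u : EuclideanSpace ℝ (Fin n)) : F :=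
  fderiv ℝ f u (EuclideanSpace.single i 1)

/-- The Christoffel symbol `Γ^k_{ij}` of the Levi-Civita connection of the metric `g_{ij}`. -/
def christoffel {n : ℕ} (g : EuclideanSpace ℝ (Fin n) → Matrix (Fin n) (Fin n) ℝ)
    (k i j : Fin n) (u : EuclideanSpace ℝ (Fin n)) : ℝ :=
  (1 / 2) * ∑ l, (g u)⁻¹ k l *
    (pd i (fun v => g v j l) u + pd j (fun v => g v i l) u - pd l (fun v => g v i j) u)

/-- The second covariant derivative `f_{,ij} = ∂²f/∂x_i∂x_j - Γ^k_{ij} ∂f/∂x_k`. -/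
def covHess {n : ℕ} (g : EuclideanSpace ℝ (Fin n) → Matrix (Fin n) (Fin n) ℝ)
    (f : EuclideanSpace ℝ (Fin n) → ℝ) (i j : Fin n) (u : EuclideanSpace ℝ (Fin n)) : ℝ :=
  pd i (pd j f) u - ∑ k, christoffel g k i j u * pd k f u

/-- The divergence `X^j_{,j} = ∂X^j/∂x_j + Γ^j_{jk} X^k` of a vector field. -/
def covDiv {n : ℕ} (g : EuclideanSpace ℝ (Fin n) → Matrix (Fin n) (Fin n) ℝ)
    (X : EuclideanSpace ℝ (Fin n) → Fin n → ℝ) (u : EuclideanSpace ℝ (Fin n)) : ℝ :=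
  ∑ j, pd j (fun v => X v j) u + ∑ j, ∑ k, christoffel g j j k u * X u k

/-- The divergence `T^{ij}_{,j} = ∂T^{ij}/∂x_j + Γ^i_{jk} T^{kj} + Γ^j_{jk} T^{ik}` of a
contravariant 2-tensor. -/
def covDivTensor {n : ℕ} (g : EuclideanSpace ℝ (Fin n) → Matrix (Fin n) (Fin n) ℝ)
    (T : EuclideanSpace ℝ (Fin n) → Matrix (Fin n) (Fin n) ℝ)
    (i : Fin n) (u : EuclideanSpace ℝ (Fin n)) : ℝ :=
  ∑ j, pd j (fun v => T v i j) u + ∑ j, ∑ k, christoffel g i j k u * T u k j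
    + ∑ j, ∑ k, christoffel g j j k u * T u i k

/-! ### A parametrized hypersurface `φ` in `ℝⁿ⁺¹` with unit normal `N` -/

/-- The induced metric `g_{ij} = ⟨∂_i φ, ∂_j φ⟩`. -/
def metric {n : ℕ} (φ : EuclideanSpace ℝ (Fin n) → EuclideanSpace ℝ (Fin (n + 1)))
    (u : EuclideanSpace ℝ (Fin n)) : Matrix (Fin n) (Fin n) ℝ :=
  Matrix.of fun i j => inner ℝ (pd i φ u) (pd j φ u)

/-- The second fundamental form `A_{ij} = ⟨∂_i ∂_j φ, N⟩`. -/
def secondForm {n : ℕ} (φ N : EuclideanSpace ℝ (Fin n) → EuclideanSpace ℝ (Fin (n + 1)))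
    (u : EuclideanSpace ℝ (Fin n)) : Matrix (Fin n) (Fin n) ℝ :=
  Matrix.of fun i j => inner ℝ (pd i (pd j φ) u) (N u)

/-- The shape operator `A^i_j = g^{ik} A_{kj}` (row index up, column index down). -/
def shape {n : ℕ} (φ N : EuclideanSpace ℝ (Fin n) → EuclideanSpace ℝ (Fin (n + 1)))
    (u : EuclideanSpace ℝ (Fin n)) : Matrix (Fin n) (Fin n) ℝ :=
  (metric φ u)⁻¹ * secondForm φ N u

/-- The weighted Newton tensor with raised index, `(T_r^∞)^{ij} = (T_r^∞)^i_k g^{kj}`. -/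
def newtonUp {n : ℕ} (μ₀ : ℝ) (r : ℕ)
    (φ N : EuclideanSpace ℝ (Fin n) → EuclideanSpace ℝ (Fin (n + 1)))
    (u : EuclideanSpace ℝ (Fin n)) : Matrix (Fin n) (Fin n) ℝ :=
  wNewton μ₀ (shape φ N u) r * (metric φ u)⁻¹

/-! ### Hypersurfaces `ψ : M → ℝⁿ⁺¹` with unit normal field `ν`

All quantities below are scalars or tensors on `M`; they are expressed in the coordinates of an
arbitrary smooth chart `e` of `M`, in which `ψ` and `ν` read `ψ ∘ e.symm` and `ν ∘ e.symm`. -/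

section Hypersurface

variable {n : ℕ} {M : Type*} [TopologicalSpace M] [ChartedSpace (EuclideanSpace ℝ (Fin n)) M]

/-- `ψ` is a smooth immersion of `M` as a hypersurface of `ℝⁿ⁺¹`, and `ν` is a smooth unit
normal vector field along it. -/
structure IsHypersurface (ψ ν : M → EuclideanSpace ℝ (Fin (n + 1))) : Prop where
  smooth : ContMDiff (𝓡 n) (𝓡 (n + 1)) ∞ ψ
  immersion : ∀ p, Function.Injective (mfderiv (𝓡 n) (𝓡 (n + 1)) ψ p)
  normal_smooth : ContMDiff (𝓡 n) (𝓡 (n + 1)) ∞ ν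
  normal_unit : ∀ p, ‖ν p‖ = 1
  normal_orthogonal : ∀ (p : M) (v : TangentSpace (𝓡 n) p),
    inner (E := EuclideanSpace ℝ (Fin (n + 1))) ℝ (mfderiv (𝓡 n) (𝓡 (n + 1)) ψ p v) (ν p) = 0

/-- `σ_r^∞`-minimality: `(r+1) σ_{r+1}^∞ - μ₀ σ_r^∞` vanishes identically on `M`. -/
def IsSigmaMinimal (μ₀ : ℝ) (r : ℕ) (ψ ν : M → EuclideanSpace ℝ (Fin (n + 1))) : Prop :=
  ∀ e ∈ IsManifold.maximalAtlas (𝓡 n) ∞ M, ∀ u ∈ e.target,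
    ((r : ℝ) + 1) * wsigma μ₀ (shape (ψ ∘ e.symm) (ν ∘ e.symm) u) (r + 1)
      - μ₀ * wsigma μ₀ (shape (ψ ∘ e.symm) (ν ∘ e.symm) u) r = 0

/-- The function `f` on `M` solves `(T_r^∞)^{ij} f_{,ij} = 0`. -/
def SolvesNewtonPDE (μ₀ : ℝ) (r : ℕ) (ψ ν : M → EuclideanSpace ℝ (Fin (n + 1)))
    (f : M → ℝ) : Prop :=
  ∀ e ∈ IsManifold.maximalAtlas (𝓡 n) ∞ M, ∀ u ∈ e.target,
    ∑ i, ∑ j, newtonUp μ₀ r (ψ ∘ e.symm) (ν ∘ e.symm) u i j *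
      covHess (metric (ψ ∘ e.symm)) (f ∘ e.symm) i j u = 0

/-- The function `f` on `M` solves `((T_r^∞)^{ij} f_{,i})_{,j} = 0`. -/
def SolvesNewtonDivPDE (μ₀ : ℝ) (r : ℕ) (ψ ν : M → EuclideanSpace ℝ (Fin (n + 1)))
    (f : M → ℝ) : Prop :=
  ∀ e ∈ IsManifold.maximalAtlas (𝓡 n) ∞ M, ∀ u ∈ e.target,
    covDiv (metric (ψ ∘ e.symm))
      (fun v j => ∑ i, newtonUp μ₀ r (ψ ∘ e.symm) (ν ∘ e.symm) v i j * pd i (f ∘ e.symm) v) u = 0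

/-- The weighted Newton tensor is divergence-free: `(T_r^∞)^{ij}_{,j} = 0`. -/
def NewtonDivFree (μ₀ : ℝ) (r : ℕ) (ψ ν : M → EuclideanSpace ℝ (Fin (n + 1))) : Prop :=
  ∀ e ∈ IsManifold.maximalAtlas (𝓡 n) ∞ M, ∀ u ∈ e.target, ∀ i,
    covDivTensor (metric (ψ ∘ e.symm)) (newtonUp μ₀ r (ψ ∘ e.symm) (ν ∘ e.symm)) i u = 0

end Hypersurface

end WeightedCurvature

end

/-! By the Gauss formula the covariant Hessian of each coordinate function is purely normal,
`ψ_{a,ij} = A_{ij} ν_a`, so contracting with the Newton tensor gives `tr(T_r^∞ A) ν_a`. Newton's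
identities turn this trace into `(r+1) σ_{r+1}^∞ - μ₀ σ_r^∞`
(`SatisfiesNewton.trace_wNewton_mul_self`). Since `ν` is a unit vector, it vanishes for all `a`
exactly when the hypersurface is minimal.

The divergence form differs from the Hessian form by `T^{ij}_{,j} ψ_{a,i}`, so it remains to see
that `T` is divergence-free. This follows by induction on the recursion `T_{r+1} = σ_{r+1}^∞ I - T_r
A`: the derivative of `σ_{r+1}^∞` is `tr(T_r ∇A)` (`pd_wsigma_succ`), and the Codazzi equation makes
it cancel the divergence of `T_r A` (`sum_covEnd_wNewton`).

The algebra is done with the generating series `s(t) = ∑ σ_r^∞ t^r = e^{μ₀ t} ∑ σ_k t^k`. Newton's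
identities say that `s' = s (p + μ₀)`, with `p` the series of power traces. Both the trace formula
and the derivative of `σ_r^∞` come from this linear equation, with no differentiation of
eigenvalues. -/

noncomputable section

namespace WeightedCurvature

open Matrix PowerSeries Finset

/-! ### Newton's identities -/

variable {n : ℕ}

/-- The generating series `∑ (-1)^j tr(A^{j+1}) t^j` of the power sums of the eigenvalues. -/
def powerSeriesTrace (A : Matrix (Fin n) (Fin n) ℝ) : ℝ⟦X⟧ :=
  PowerSeries.mk fun j => (-1) ^ j * (A ^ (j + 1)).trace

theorem sigma_zero (A : Matrix (Fin n) (Fin n) ℝ) : sigma A 0 = 1 := by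
  simp [sigma, Multiset.esymm]

theorem sigma_conj (P : (Matrix (Fin n) (Fin n) ℝ)ˣ) (A : Matrix (Fin n) (Fin n) ℝ) (k : ℕ) :
    sigma (P.val * A * (P⁻¹).val) k = sigma A k := by
  rw [Matrix.coe_units_inv, sigma, Matrix.charpoly_units_conj, sigma]

theorem trace_conj_pow (P : (Matrix (Fin n) (Fin n) ℝ)ˣ) (A : Matrix (Fin n) (Fin n) ℝ) (k : ℕ) :
    ((P.val * A * (P⁻¹).val) ^ k).trace = (A ^ k).trace := by
  rw [Units.conj_pow, Matrix.trace_mul_cycle, Units.inv_mul, one_mul]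

theorem esymm_newton {ι : Type*} [Fintype ι] (d : ι → ℝ) (k : ℕ) :
    ((k : ℝ) + 1) * ((univ : Finset ι).val.map d).esymm (k + 1) =
      ∑ a ∈ antidiagonal k, ((univ : Finset ι).val.map d).esymm a.1 *
        ((-1) ^ a.2 * ∑ i, d i ^ (a.2 + 1)) := by
  classical
  have h := congrArg (MvPolynomial.aeval d) (MvPolynomial.mul_esymm_eq_sum ι ℝ (k + 1))
  simp only [map_mul, map_sum, map_pow, map_neg, map_one, map_natCast,
    MvPolynomial.aeval_esymm_eq_multiset_esymm, MvPolynomial.psum, MvPolynomial.aeval_X] at h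
  -- The pair `(k + 1, 0)` split off here is the one that the filter in Newton's identity excludes.
  rw [Finset.sum_filter, Finset.Nat.sum_antidiagonal_succ'] at h
  push_cast at h
  rw [h]
  simp only [lt_irrefl, if_false, zero_add]
  rw [mul_sum]
  refine sum_congr rfl fun a ha => ?_
  have hk : a.1 + a.2 = k := by simpa using ha
  rw [if_pos (by omega), ← hk]
  have : ((-1 : ℝ)) ^ (a.1 + a.2 + 1 + 1) * (-1) ^ a.1 = (-1) ^ a.2 := by
    rw [← pow_add, show a.1 + a.2 + 1 + 1 + a.1 = 2 * (a.1 + 1) + a.2 by ring, pow_add, pow_mul]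
    simp
  rw [← this]
  ring

theorem sigma_newton_of_isHermitian {A : Matrix (Fin n) (Fin n) ℝ} (hA : A.IsHermitian) (k : ℕ) :
    ((k : ℝ) + 1) * sigma A (k + 1) =
      ∑ a ∈ antidiagonal k, sigma A a.1 * ((-1) ^ a.2 * (A ^ (a.2 + 1)).trace) := by
  have hs : ∀ k, sigma A k = ((univ : Finset (Fin n)).val.map hA.eigenvalues).esymm k := by
    intro k
    rw [sigma, hA.roots_charpoly_eq_eigenvalues]
    rfl
  have ht : ∀ k, (A ^ k).trace = ∑ i, hA.eigenvalues i ^ k := by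
    intro k
    conv_lhs => rw [hA.spectral_theorem, ← map_pow, Unitary.conjStarAlgAut_apply,
      Matrix.trace_mul_cycle, Unitary.coe_star_mul_self, one_mul, Matrix.diagonal_pow,
      Matrix.trace_diagonal]
    simp
  simp only [hs, ht]
  exact esymm_newton _ k

/-- The product of the inverse of a positive definite matrix and a symmetric matrix is similar to a
symmetric matrix. -/
theorem exists_conj_isHermitian {g S : Matrix (Fin n) (Fin n) ℝ} (hg : g.PosDef)
    (hS : S.IsHermitian) : ∃ (P : (Matrix (Fin n) (Fin n) ℝ)ˣ) (H : Matrix (Fin n) (Fin n) ℝ),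
      H.IsHermitian ∧ g⁻¹ * S = P.val * H * (P⁻¹).val := by
  obtain ⟨B, hB⟩ : ∃ B : Matrix (Fin n) (Fin n) ℝ, g = Bᴴ * B := by
    open scoped MatrixOrder in
    exact CStarAlgebra.nonneg_iff_eq_star_mul_self.mp hg.posSemidef.nonneg
  have hBu : IsUnit B := by
    have h := hg.isUnit
    rw [hB, Matrix.isUnit_iff_isUnit_det, Matrix.det_mul] at h
    exact (Matrix.isUnit_iff_isUnit_det B).mpr (isUnit_of_mul_isUnit_right h)
  have hd : IsUnit B.det := (Matrix.isUnit_iff_isUnit_det B).mp hBu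
  -- With `g = Bᴴ B`, one has `g⁻¹ S = B⁻¹ (B⁻ᴴ S B⁻¹) B`.
  refine ⟨hBu.unit⁻¹, (B⁻¹)ᴴ * S * B⁻¹, Matrix.isHermitian_conjTranspose_mul_mul _ hS, ?_⟩
  rw [inv_inv, Matrix.coe_units_inv, IsUnit.unit_spec, hB, Matrix.mul_inv_rev,
    Matrix.conjTranspose_nonsing_inv]
  simp only [mul_assoc]
  rw [Matrix.nonsing_inv_mul _ hd, mul_one]

/-- `sigma` sees only the real roots of the characteristic polynomial, while traces see all
eigenvalues. Similarity to a symmetric matrix makes every eigenvalue real, so that the two match. -/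
theorem sigma_newton {g S : Matrix (Fin n) (Fin n) ℝ} (hg : g.PosDef) (hS : S.IsHermitian)
    (k : ℕ) : ((k : ℝ) + 1) * sigma (g⁻¹ * S) (k + 1) = ∑ a ∈ antidiagonal k,
      sigma (g⁻¹ * S) a.1 * ((-1) ^ a.2 * ((g⁻¹ * S) ^ (a.2 + 1)).trace) := by
  obtain ⟨P, H, hH, h⟩ := exists_conj_isHermitian hg hS
  simp only [h, sigma_conj, trace_conj_pow]
  exact sigma_newton_of_isHermitian hH k

/-! ### The weighted symmetric functions -/

/-- The generating series of the weighted elementary symmetric polynomials. -/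
def wsigmaSeries (μ₀ : ℝ) (A : Matrix (Fin n) (Fin n) ℝ) : ℝ⟦X⟧ :=
  PowerSeries.mk (wsigma μ₀ A)

theorem wsigma_zero (μ₀ : ℝ) (A : Matrix (Fin n) (Fin n) ℝ) : wsigma μ₀ A 0 = 1 := by
  simp [wsigma, sigma_zero]

/-- The first factor is `e^{μ₀ t}`; the weight therefore only adds the constant `μ₀` to the
logarithmic derivative. -/
theorem wsigmaSeries_eq (μ₀ : ℝ) (A : Matrix (Fin n) (Fin n) ℝ) :
    wsigmaSeries μ₀ A =
      PowerSeries.mk (fun j => μ₀ ^ j / (j.factorial : ℝ)) * PowerSeries.mk (sigma A) := by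
  ext r
  rw [wsigmaSeries, coeff_mk, wsigma, PowerSeries.coeff_mul]
  simp only [coeff_mk]
  rw [Finset.Nat.sum_antidiagonal_eq_sum_range_succ
    (fun i j => μ₀ ^ i / (i.factorial : ℝ) * sigma A j)]

/-- `A` satisfies Newton's identities, in terms of generating series. -/
def SatisfiesNewton (A : Matrix (Fin n) (Fin n) ℝ) : Prop :=
  d⁄dX ℝ (PowerSeries.mk (sigma A)) = PowerSeries.mk (sigma A) * powerSeriesTrace A

theorem satisfiesNewton_inv_mul {g S : Matrix (Fin n) (Fin n) ℝ} (hg : g.PosDef)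
    (hS : S.IsHermitian) : SatisfiesNewton (g⁻¹ * S) := by
  unfold SatisfiesNewton
  ext k
  rw [coeff_derivative, PowerSeries.coeff_mul]
  simp only [powerSeriesTrace, coeff_mk]
  rw [mul_comm, sigma_newton hg hS]

theorem SatisfiesNewton.derivative_wsigmaSeries {A : Matrix (Fin n) (Fin n) ℝ}
    (hA : SatisfiesNewton A) (μ₀ : ℝ) : d⁄dX ℝ (wsigmaSeries μ₀ A) =
      wsigmaSeries μ₀ A * (powerSeriesTrace A + PowerSeries.C μ₀) := by
  have hE : d⁄dX ℝ (PowerSeries.mk (fun j => μ₀ ^ j / (j.factorial : ℝ))) =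
      PowerSeries.C μ₀ * PowerSeries.mk (fun j => μ₀ ^ j / (j.factorial : ℝ)) := by
    ext k
    rw [coeff_derivative, PowerSeries.coeff_C_mul, coeff_mk, coeff_mk, Nat.factorial_succ]
    push_cast
    have : (k.factorial : ℝ) ≠ 0 := by positivity
    have : (k : ℝ) + 1 ≠ 0 := by positivity
    field_simp
    ring
  have hA' : d⁄dX ℝ (PowerSeries.mk (sigma A)) = _ := hA
  rw [wsigmaSeries_eq, Derivation.leibniz, hE, hA']
  simp only [smul_eq_mul]
  ring

theorem SatisfiesNewton.wsigma_succ {A : Matrix (Fin n) (Fin n) ℝ} (hA : SatisfiesNewton A)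
    (μ₀ : ℝ) (r : ℕ) : ((r : ℝ) + 1) * wsigma μ₀ A (r + 1) =
      ∑ a ∈ antidiagonal r, wsigma μ₀ A a.1 * ((-1) ^ a.2 * (A ^ (a.2 + 1)).trace)
        + μ₀ * wsigma μ₀ A r := by
  have h := congrArg (PowerSeries.coeff r) (hA.derivative_wsigmaSeries μ₀)
  rw [coeff_derivative, mul_add (wsigmaSeries μ₀ A), map_add, PowerSeries.coeff_mul_C, PowerSeries.coeff_mul] at h
  simp only [wsigmaSeries, powerSeriesTrace, coeff_mk] at h
  linarith

/-- This exhibits the trace as a coefficient of a product of series. It is used with `B = A` for the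
minimality equation and with `B` a derivative of `A` for the variation of `wsigma`. -/
theorem trace_wNewton_mul (μ₀ : ℝ) (A B : Matrix (Fin n) (Fin n) ℝ) (r : ℕ) :
    (wNewton μ₀ A r * B).trace =
      ∑ a ∈ antidiagonal r, wsigma μ₀ A a.1 * ((-1) ^ a.2 * (A ^ a.2 * B).trace) := by
  rw [← Finset.Nat.sum_antidiagonal_swap]
  simp only [Prod.fst_swap, Prod.snd_swap]
  rw [Finset.Nat.sum_antidiagonal_eq_sum_range_succ
    (fun i j => wsigma μ₀ A j * ((-1) ^ i * (A ^ i * B).trace)), wNewton, sum_mul,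
    Matrix.trace_sum]
  refine sum_congr rfl fun j _ => ?_
  rw [Matrix.smul_mul, Matrix.trace_smul, smul_eq_mul]
  ring

theorem SatisfiesNewton.trace_wNewton_mul_self {A : Matrix (Fin n) (Fin n) ℝ}
    (hA : SatisfiesNewton A) (μ₀ : ℝ) (r : ℕ) : (wNewton μ₀ A r * A).trace =
      ((r : ℝ) + 1) * wsigma μ₀ A (r + 1) - μ₀ * wsigma μ₀ A r := by
  rw [trace_wNewton_mul, hA.wsigma_succ]
  simp only [pow_succ]
  ring

theorem wNewton_zero (μ₀ : ℝ) (A : Matrix (Fin n) (Fin n) ℝ) : wNewton μ₀ A 0 = 1 := by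
  simp [wNewton, wsigma_zero]

/-- The term `j = 0` splits off and the others share a factor `-A`. The later inductions on `r` rest
on this recursion. -/
theorem wNewton_succ (μ₀ : ℝ) (A : Matrix (Fin n) (Fin n) ℝ) (r : ℕ) :
    wNewton μ₀ A (r + 1) = wsigma μ₀ A (r + 1) • 1 - wNewton μ₀ A r * A := by
  rw [wNewton, sum_range_succ', wNewton, sum_mul, sub_eq_add_neg, ← sum_neg_distrib, add_comm]
  congr 1
  · simp
  · refine sum_congr rfl fun j _ => ?_
    rw [Matrix.smul_mul, ← pow_succ, ← neg_smul, Nat.add_sub_add_right]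
    congr 1
    ring

theorem wNewton_commute (μ₀ : ℝ) (A : Matrix (Fin n) (Fin n) ℝ) (r : ℕ) :
    Commute (wNewton μ₀ A r) A :=
  Commute.sum_left _ _ _ fun j _ => ((Commute.refl A).pow_left j).smul_left _

/-- A variation `Ds` of the coefficients of a series `s` with `s' = s p` and `s₀` constant, under a
variation `(t q)'` of `p`, is `Ds = t q s`. -/
theorem variation_eq_of_derivative_eq {s Ds p q : ℝ⟦X⟧} (hs : d⁄dX ℝ s = s * p)
    (hDs : d⁄dX ℝ Ds = Ds * p + s * d⁄dX ℝ (PowerSeries.X * q))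
    (h0 : PowerSeries.coeff 0 Ds = 0) : Ds = PowerSeries.X * q * s := by
  -- Uniqueness for the linear equation `Z' = Z p`: coefficient `k + 1` is determined by the earlier
  -- ones. It is applied to the difference of the two sides.
  have key : ∀ Z : ℝ⟦X⟧, d⁄dX ℝ Z = Z * p → PowerSeries.coeff 0 Z = 0 → Z = 0 := by
    intro Z hZ hZ0
    ext k
    rw [map_zero]
    induction k using Nat.strong_induction_on with
    | _ k ih =>
      cases k with
      | zero => exact hZ0
      | succ k =>
        have h := congrArg (PowerSeries.coeff k) hZ
        rw [coeff_derivative, PowerSeries.coeff_mul, sum_eq_zero] at h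
        · have : (k : ℝ) + 1 ≠ 0 := by positivity
          simpa [this] using h
        · intro a ha
          have : a.1 + a.2 = k := by simpa using ha
          rw [ih a.1 (by omega), zero_mul]
  refine sub_eq_zero.mp (key _ ?_ ?_)
  · rw [map_sub, hDs, Derivation.leibniz (d⁄dX ℝ) (PowerSeries.X * q) s, hs]
    simp only [smul_eq_mul]
    ring
  · rw [map_sub, h0, mul_assoc, PowerSeries.coeff_zero_X_mul, sub_zero]

end WeightedCurvature

end

/-! ### Differentiation of matrix fields, and the divergence of Newton tensors of Codazzi fields. -/

noncomputable section

namespace WeightedCurvature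

open Matrix PowerSeries Finset Filter Topology

variable {n : ℕ}

/-! ### Partial derivatives of functions and of matrices of functions -/

section PartialDerivatives

variable {u : EuclideanSpace ℝ (Fin n)}

theorem pd_congr {F : Type*} [NormedAddCommGroup F] [NormedSpace ℝ F] (i : Fin n)
    {f h : EuclideanSpace ℝ (Fin n) → F} (hfh : f =ᶠ[𝓝 u] h) : pd i f u = pd i h u := by
  rw [pd, pd, hfh.fderiv_eq]

theorem pd_const (i : Fin n) (c : ℝ) : pd i (fun _ => c) u = 0 := by
  simp [pd]

theorem pd_add (i : Fin n) {f h : EuclideanSpace ℝ (Fin n) → ℝ} (hf : DifferentiableAt ℝ f u)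
    (hh : DifferentiableAt ℝ h u) : pd i (fun v => f v + h v) u = pd i f u + pd i h u := by
  rw [pd, fderiv_fun_add hf hh]
  rfl

theorem pd_sub (i : Fin n) {f h : EuclideanSpace ℝ (Fin n) → ℝ} (hf : DifferentiableAt ℝ f u)
    (hh : DifferentiableAt ℝ h u) : pd i (fun v => f v - h v) u = pd i f u - pd i h u := by
  rw [pd, fderiv_fun_sub hf hh]
  rfl

theorem pd_mul (i : Fin n) {f h : EuclideanSpace ℝ (Fin n) → ℝ} (hf : DifferentiableAt ℝ f u)
    (hh : DifferentiableAt ℝ h u) :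
    pd i (fun v => f v * h v) u = pd i f u * h u + f u * pd i h u := by
  rw [pd, fderiv_fun_mul hf hh]
  simp [pd]
  ring

theorem pd_const_mul (i : Fin n) (c : ℝ) {f : EuclideanSpace ℝ (Fin n) → ℝ}
    (hf : DifferentiableAt ℝ f u) : pd i (fun v => c * f v) u = c * pd i f u := by
  rw [pd_mul i (differentiableAt_const c) hf, pd_const, zero_mul, zero_add]

theorem pd_sum {ι : Type*} (i : Fin n) (s : Finset ι) {f : ι → EuclideanSpace ℝ (Fin n) → ℝ}
    (hf : ∀ a ∈ s, DifferentiableAt ℝ (f a) u) :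
    pd i (fun v => ∑ a ∈ s, f a v) u = ∑ a ∈ s, pd i (f a) u := by
  rw [pd, fderiv_fun_sum hf]
  simp [pd]

/-- A matrix-valued function whose entries are differentiable at `u`. -/
def MatDifferentiableAt (B : EuclideanSpace ℝ (Fin n) → Matrix (Fin n) (Fin n) ℝ)
    (u : EuclideanSpace ℝ (Fin n)) : Prop :=
  ∀ a b, DifferentiableAt ℝ (fun v => B v a b) u

/-- The entrywise partial derivative of a matrix-valued function. -/
def pdMat (j : Fin n) (B : EuclideanSpace ℝ (Fin n) → Matrix (Fin n) (Fin n) ℝ)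
    (u : EuclideanSpace ℝ (Fin n)) : Matrix (Fin n) (Fin n) ℝ :=
  Matrix.of fun a b => pd j (fun v => B v a b) u

variable {B C : EuclideanSpace ℝ (Fin n) → Matrix (Fin n) (Fin n) ℝ}

theorem MatDifferentiableAt.mul (hB : MatDifferentiableAt B u) (hC : MatDifferentiableAt C u) :
    MatDifferentiableAt (fun v => B v * C v) u := by
  intro a b
  simp only [Matrix.mul_apply]
  exact DifferentiableAt.fun_sum fun c _ => (hB a c).mul (hC c b)

theorem MatDifferentiableAt.sub (hB : MatDifferentiableAt B u) (hC : MatDifferentiableAt C u) :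
    MatDifferentiableAt (fun v => B v - C v) u :=
  fun a b => (hB a b).sub (hC a b)

theorem MatDifferentiableAt.smul_one {f : EuclideanSpace ℝ (Fin n) → ℝ}
    (hf : DifferentiableAt ℝ f u) :
    MatDifferentiableAt (fun v => f v • (1 : Matrix (Fin n) (Fin n) ℝ)) u := by
  intro a b
  simp only [Matrix.smul_apply, smul_eq_mul]
  exact hf.mul_const _

theorem MatDifferentiableAt.const (B : Matrix (Fin n) (Fin n) ℝ) :
    MatDifferentiableAt (fun _ => B) u :=
  fun _ _ => differentiableAt_const _

theorem MatDifferentiableAt.pow (hB : MatDifferentiableAt B u) (k : ℕ) :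
    MatDifferentiableAt (fun v => B v ^ k) u := by
  induction k with
  | zero => simpa using MatDifferentiableAt.const 1
  | succ k ih => simpa only [pow_succ] using ih.mul hB

theorem MatDifferentiableAt.trace (hB : MatDifferentiableAt B u) :
    DifferentiableAt ℝ (fun v => (B v).trace) u := by
  simp only [Matrix.trace, Matrix.diag_apply]
  exact DifferentiableAt.fun_sum fun c _ => hB c c

theorem MatDifferentiableAt.det (hB : MatDifferentiableAt B u) :
    DifferentiableAt ℝ (fun v => (B v).det) u := by
  simp only [Matrix.det_apply']
  exact DifferentiableAt.fun_sum fun c _ => (differentiableAt_const _).mul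
    (HasFDerivAt.finsetProd fun i _ => (hB (c i) i).hasFDerivAt).differentiableAt

/-- By Cramer's rule: adjugate entries are determinants of `B` with one row replaced by a constant
one. -/
theorem MatDifferentiableAt.inv (hB : MatDifferentiableAt B u) (hu : (B u).det ≠ 0) :
    MatDifferentiableAt (fun v => (B v)⁻¹) u := by
  intro a b
  simp only [Matrix.inv_def, Ring.inverse_eq_inv', Matrix.smul_apply, smul_eq_mul,
    Matrix.adjugate_apply]
  refine (hB.det.inv hu).mul (MatDifferentiableAt.det fun c d => ?_)
  simp only [Matrix.updateRow_apply]
  split_ifs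
  · exact differentiableAt_const _
  · exact hB c d

theorem pdMat_congr (j : Fin n) (h : B =ᶠ[𝓝 u] C) : pdMat j B u = pdMat j C u := by
  ext a b
  exact pd_congr j (h.mono fun v hv => congrFun (congrFun hv a) b)

theorem pdMat_const (j : Fin n) (B : Matrix (Fin n) (Fin n) ℝ) : pdMat j (fun _ => B) u = 0 := by
  ext a b
  exact pd_const j _

theorem pdMat_mul (j : Fin n) (hB : MatDifferentiableAt B u) (hC : MatDifferentiableAt C u) :
    pdMat j (fun v => B v * C v) u = pdMat j B u * C u + B u * pdMat j C u := by
  ext a b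
  simp only [pdMat, Matrix.of_apply, Matrix.mul_apply, Matrix.add_apply]
  rw [pd_sum j _ fun c _ => (hB a c).fun_mul (hC c b), ← sum_add_distrib]
  exact sum_congr rfl fun c _ => pd_mul j (hB a c) (hC c b)

theorem pdMat_sub (j : Fin n) (hB : MatDifferentiableAt B u) (hC : MatDifferentiableAt C u) :
    pdMat j (fun v => B v - C v) u = pdMat j B u - pdMat j C u := by
  ext a b
  exact pd_sub j (hB a b) (hC a b)

theorem pdMat_smul_one (j : Fin n) {f : EuclideanSpace ℝ (Fin n) → ℝ}
    (hf : DifferentiableAt ℝ f u) :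
    pdMat j (fun v => f v • (1 : Matrix (Fin n) (Fin n) ℝ)) u = pd j f u • 1 := by
  ext a b
  simp only [pdMat, Matrix.of_apply, Matrix.smul_apply, smul_eq_mul]
  rw [pd_mul j hf (differentiableAt_const _), pd_const, mul_zero, add_zero]

theorem pdMat_transpose (j : Fin n) : pdMat j (fun v => (B v)ᵀ) u = (pdMat j B u)ᵀ := rfl

theorem pd_trace (j : Fin n) (hB : MatDifferentiableAt B u) :
    pd j (fun v => (B v).trace) u = (pdMat j B u).trace := by
  simp only [Matrix.trace, Matrix.diag_apply]
  exact pd_sum j _ fun c _ => hB c c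

/-- The derivative of `B` need not commute with `B`, but under the trace cyclicity repairs this. The
commuting factor `P` strengthens the induction: each factor peeled off the power is absorbed into
it. -/
theorem trace_pdMat_pow_mul (j : Fin n) (hB : MatDifferentiableAt B u) (k : ℕ)
    (P : Matrix (Fin n) (Fin n) ℝ) (hP : Commute P (B u)) :
    (pdMat j (fun v => B v ^ (k + 1)) u * P).trace =
      ((k : ℝ) + 1) * (P * B u ^ k * pdMat j B u).trace := by
  induction k generalizing P with
  | zero => simp [Matrix.trace_mul_comm P]
  | succ k ih =>
    simp only [pow_succ _ (k + 1)]
    rw [pdMat_mul j (hB.pow _) hB, add_mul, Matrix.trace_add, mul_assoc,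
      ih _ ((Commute.refl (B u)).mul_left hP), Matrix.trace_mul_cycle _ _ P]
    have : B u * P * B u ^ k = P * (B u ^ k * B u) := by
      rw [← hP.eq, mul_assoc, ← pow_succ', ← pow_succ]
    rw [this, ← pow_succ]
    push_cast
    ring

theorem pd_trace_pow (j : Fin n) (hB : MatDifferentiableAt B u) (k : ℕ) :
    pd j (fun v => (B v ^ (k + 1)).trace) u =
      ((k : ℝ) + 1) * (B u ^ k * pdMat j B u).trace := by
  have h := trace_pdMat_pow_mul j hB k 1 (Commute.one_left _)
  rw [mul_one, one_mul] at h
  rw [pd_trace j (hB.pow _), h]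

end PartialDerivatives

/-! ### Derivatives of the weighted symmetric functions -/

section WeightedDerivatives

variable {u : EuclideanSpace ℝ (Fin n)} {A : EuclideanSpace ℝ (Fin n) → Matrix (Fin n) (Fin n) ℝ}

theorem eventually_wsigma_succ (hN : ∀ᶠ v in 𝓝 u, SatisfiesNewton (A v)) (μ₀ : ℝ) (r : ℕ) :
    (fun v => wsigma μ₀ (A v) (r + 1)) =ᶠ[𝓝 u] fun v => ((r : ℝ) + 1)⁻¹ *
      (∑ a ∈ antidiagonal r, wsigma μ₀ (A v) a.1 * ((-1) ^ a.2 * (A v ^ (a.2 + 1)).trace)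
        + μ₀ * wsigma μ₀ (A v) r) := by
  filter_upwards [hN] with v hv
  have : (r : ℝ) + 1 ≠ 0 := by positivity
  rw [← hv.wsigma_succ, inv_mul_cancel_left₀ this]

/-- Defined through roots, `wsigma` is not visibly differentiable; Newton's identities build it
recursively from traces of powers of `A`. -/
theorem differentiableAt_wsigma (hA : MatDifferentiableAt A u)
    (hN : ∀ᶠ v in 𝓝 u, SatisfiesNewton (A v)) (μ₀ : ℝ) (r : ℕ) :
    DifferentiableAt ℝ (fun v => wsigma μ₀ (A v) r) u := by
  induction r using Nat.strong_induction_on with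
  | _ r ih =>
    cases r with
    | zero => simp only [wsigma_zero, differentiableAt_const]
    | succ r =>
      refine DifferentiableAt.congr_of_eventuallyEq ?_ (eventually_wsigma_succ hN μ₀ r)
      refine ((DifferentiableAt.fun_sum fun a ha => ?_).add
        ((ih r (by omega)).const_mul μ₀)).const_mul _
      have : a.1 + a.2 = r := by simpa using ha
      exact (ih a.1 (by omega)).mul ((hA.pow _).trace.const_mul _)

theorem pd_wsigma_succ_recursion (hA : MatDifferentiableAt A u)
    (hN : ∀ᶠ v in 𝓝 u, SatisfiesNewton (A v)) (μ₀ : ℝ) (j : Fin n) (r : ℕ) :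
    pd j (fun v => wsigma μ₀ (A v) (r + 1)) u * ((r : ℝ) + 1) =
      ∑ a ∈ antidiagonal r, (pd j (fun v => wsigma μ₀ (A v) a.1) u *
          ((-1) ^ a.2 * (A u ^ (a.2 + 1)).trace) +
        wsigma μ₀ (A u) a.1 * ((-1) ^ a.2 * (((a.2 : ℝ) + 1) *
          (A u ^ a.2 * pdMat j A u).trace))) + μ₀ * pd j (fun v => wsigma μ₀ (A v) r) u := by
  have hw := differentiableAt_wsigma hA hN μ₀
  have ht : ∀ k, DifferentiableAt ℝ (fun v => (-1 : ℝ) ^ k * (A v ^ (k + 1)).trace) u :=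
    fun k => (hA.pow _).trace.const_mul _
  have hs : DifferentiableAt ℝ (fun v => ∑ a ∈ antidiagonal r,
      wsigma μ₀ (A v) a.1 * ((-1) ^ a.2 * (A v ^ (a.2 + 1)).trace)) u :=
    DifferentiableAt.fun_sum fun a _ => (hw a.1).mul (ht a.2)
  rw [pd_congr j (eventually_wsigma_succ hN μ₀ r),
    pd_const_mul j _ (hs.fun_add ((hw r).const_mul μ₀)), pd_add j hs ((hw r).const_mul μ₀),
    pd_const_mul j _ (hw r), pd_sum j _ fun a _ => (hw a.1).mul (ht a.2)]
  have : (r : ℝ) + 1 ≠ 0 := by positivity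
  rw [mul_comm, mul_inv_cancel_left₀ this]
  congr 1
  refine sum_congr rfl fun a _ => ?_
  rw [pd_mul j (hw a.1) (ht a.2), pd_const_mul j _ (hA.pow _).trace, pd_trace_pow j hA]

/-- The derivative of `σ_{r+1}^∞` is `tr(T_r^∞ dA)`. -/
theorem pd_wsigma_succ (hA : MatDifferentiableAt A u)
    (hN : ∀ᶠ v in 𝓝 u, SatisfiesNewton (A v)) (μ₀ : ℝ) (j : Fin n) (r : ℕ) :
    pd j (fun v => wsigma μ₀ (A v) (r + 1)) u =
      (wNewton μ₀ (A u) r * pdMat j A u).trace := by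
  have hs := hN.self_of_nhds.derivative_wsigmaSeries μ₀
  -- Since `∂ tr(A^{k+1}) = (k+1) tr(A^k ∂A)`, the variation of `powerSeriesTrace` is `(t q)'` for
  -- this `q`.
  have key := variation_eq_of_derivative_eq hs
    (Ds := PowerSeries.mk fun r => pd j (fun v => wsigma μ₀ (A v) r) u)
    (q := PowerSeries.mk fun k => (-1) ^ k * (A u ^ k * pdMat j A u).trace) ?_ ?_
  · have h := congrArg (PowerSeries.coeff (r + 1)) key
    rw [coeff_mk, mul_assoc, PowerSeries.coeff_succ_X_mul, mul_comm, PowerSeries.coeff_mul] at h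
    rw [h, trace_wNewton_mul]
    simp only [coeff_mk, wsigmaSeries]
  · ext r
    rw [coeff_derivative, coeff_mk, pd_wsigma_succ_recursion hA hN, map_add,
      mul_add (PowerSeries.mk _), map_add, PowerSeries.coeff_mul_C, PowerSeries.coeff_mul,
      PowerSeries.coeff_mul, sum_add_distrib]
    simp only [coeff_mk, wsigmaSeries, powerSeriesTrace, coeff_derivative,
      PowerSeries.coeff_succ_X_mul]
    rw [mul_comm μ₀, add_right_comm]
    congr 1
    refine sum_congr rfl fun a _ => ?_
    ring
  · rw [coeff_mk]
    simp only [wsigma_zero, pd_const]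

theorem MatDifferentiableAt.wNewton (hA : MatDifferentiableAt A u)
    (hN : ∀ᶠ v in 𝓝 u, SatisfiesNewton (A v)) (μ₀ : ℝ) (r : ℕ) :
    MatDifferentiableAt (fun v => wNewton μ₀ (A v) r) u := by
  induction r with
  | zero => simpa only [wNewton_zero] using MatDifferentiableAt.const 1
  | succ r ih =>
    simp only [wNewton_succ]
    exact (MatDifferentiableAt.smul_one (differentiableAt_wsigma hA hN μ₀ _)).sub (ih.mul hA)

end WeightedDerivatives

/-! ### Divergence of the weighted Newton tensor -/

section Divergence

variable {u : EuclideanSpace ℝ (Fin n)}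

/-- The covariant derivative `B^i_{k,j}` of an endomorphism field, for a connection with
matrices `(Γ_j)^i_k`. -/
def covEnd (Γ : Fin n → Matrix (Fin n) (Fin n) ℝ) (j : Fin n)
    (B : EuclideanSpace ℝ (Fin n) → Matrix (Fin n) (Fin n) ℝ)
    (u : EuclideanSpace ℝ (Fin n)) : Matrix (Fin n) (Fin n) ℝ :=
  pdMat j B u + Γ j * B u - B u * Γ j

variable {A : EuclideanSpace ℝ (Fin n) → Matrix (Fin n) (Fin n) ℝ}
  {Γ : Fin n → Matrix (Fin n) (Fin n) ℝ}

theorem covEnd_wNewton_succ (hA : MatDifferentiableAt A u)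
    (hN : ∀ᶠ v in 𝓝 u, SatisfiesNewton (A v)) (μ₀ : ℝ) (j : Fin n) (r : ℕ) :
    covEnd Γ j (fun v => wNewton μ₀ (A v) (r + 1)) u =
      (wNewton μ₀ (A u) r * covEnd Γ j A u).trace • 1
        - covEnd Γ j (fun v => wNewton μ₀ (A v) r) u * A u
        - wNewton μ₀ (A u) r * covEnd Γ j A u := by
  have hT := hA.wNewton hN μ₀ r
  have hw := differentiableAt_wsigma hA hN μ₀ (r + 1)
  -- The connection enters through the commutator `[Γ_j, A]`, whose trace against `wNewton` vanishes
  -- because `wNewton` commutes with `A`.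
  have htr : (wNewton μ₀ (A u) r * covEnd Γ j A u).trace =
      (wNewton μ₀ (A u) r * pdMat j A u).trace := by
    rw [covEnd, mul_sub, mul_add, Matrix.trace_sub, Matrix.trace_add]
    have : (wNewton μ₀ (A u) r * (Γ j * A u)).trace =
        (wNewton μ₀ (A u) r * (A u * Γ j)).trace := by
      rw [← mul_assoc, Matrix.trace_mul_cycle, ← (wNewton_commute μ₀ (A u) r).eq, mul_assoc]
    rw [this]
    ring
  rw [htr]
  simp only [covEnd, wNewton_succ]
  rw [pdMat_sub j (MatDifferentiableAt.smul_one hw) (hT.mul hA), pdMat_smul_one j hw,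
    pdMat_mul j hT hA, pd_wsigma_succ hA hN]
  simp only [mul_sub, sub_mul, add_mul, mul_add, Matrix.smul_mul, Matrix.mul_smul, one_mul,
    mul_one, mul_assoc]
  abel

/-- In the recursion for the covariant derivative, the middle term is the previous divergence times
`A`. Codazzi turns `∑ T^j_l A^l_{k,j}` into `∑ T^j_l A^l_{j,k} = tr(T ∇_k A)`, which cancels the
scalar term. -/
theorem sum_covEnd_wNewton (hA : MatDifferentiableAt A u)
    (hN : ∀ᶠ v in 𝓝 u, SatisfiesNewton (A v))
    (hcod : ∀ i j k, covEnd Γ j A u i k = covEnd Γ k A u i j) (μ₀ : ℝ) (r : ℕ) (k : Fin n) :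
    ∑ j, covEnd Γ j (fun v => wNewton μ₀ (A v) r) u j k = 0 := by
  induction r generalizing k with
  | zero => simp [wNewton_zero, covEnd, pdMat_const]
  | succ r ih =>
    simp only [covEnd_wNewton_succ hA hN, Matrix.sub_apply, sum_sub_distrib]
    have h1 : ∑ j, ((wNewton μ₀ (A u) r * covEnd Γ j A u).trace •
        (1 : Matrix (Fin n) (Fin n) ℝ)) j k = (wNewton μ₀ (A u) r * covEnd Γ k A u).trace := by
      simp [Matrix.one_apply]
    have h2 : ∑ j, (covEnd Γ j (fun v => wNewton μ₀ (A v) r) u * A u) j k = 0 := by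
      simp only [Matrix.mul_apply]
      rw [sum_comm]
      simp only [← sum_mul, ih, zero_mul, sum_const_zero]
    have h3 : ∑ j, (wNewton μ₀ (A u) r * covEnd Γ j A u) j k =
        (wNewton μ₀ (A u) r * covEnd Γ k A u).trace := by
      simp only [Matrix.trace, Matrix.diag_apply, Matrix.mul_apply, hcod _ _ k]
    rw [h1, h2, h3]
    ring

/-- Each `A^j g⁻¹ = g⁻¹ S g⁻¹ ⋯ S g⁻¹` is a palindrome in symmetric matrices. -/
theorem wNewton_mul_inv_symm {g S : Matrix (Fin n) (Fin n) ℝ} (hg : gᵀ = g) (hS : Sᵀ = S)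
    (μ₀ : ℝ) (r : ℕ) :
    (wNewton μ₀ (g⁻¹ * S) r * g⁻¹)ᵀ = wNewton μ₀ (g⁻¹ * S) r * g⁻¹ := by
  have hgi : (g⁻¹)ᵀ = g⁻¹ := by rw [Matrix.transpose_nonsing_inv, hg]
  induction r with
  | zero => simp [wNewton_zero, hgi]
  | succ r ih =>
    rw [wNewton_succ]
    rw [Matrix.transpose_mul, hgi] at ih
    rw [Matrix.transpose_mul, (wNewton_commute _ _ _).eq]
    simp only [Matrix.transpose_sub, Matrix.transpose_smul, Matrix.transpose_one,
      Matrix.transpose_mul, hgi, hS, mul_sub, sub_mul, Matrix.smul_mul, Matrix.mul_smul, one_mul,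
      mul_one]
    rw [← mul_assoc g⁻¹, ih, ← (wNewton_commute μ₀ (g⁻¹ * S) r).eq]
    simp only [mul_assoc]

/-- The derivative of the inverse of a parallel metric. -/
theorem pdMat_inv {g : EuclideanSpace ℝ (Fin n) → Matrix (Fin n) (Fin n) ℝ} (j : Fin n)
    (hg : MatDifferentiableAt g u) (hdet : ∀ᶠ v in 𝓝 u, (g v).det ≠ 0)
    (hpar : pdMat j g u = g u * Γ j + (Γ j)ᵀ * g u) :
    pdMat j (fun v => (g v)⁻¹) u = -(Γ j * (g u)⁻¹) - (g u)⁻¹ * (Γ j)ᵀ := by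
  have hu : IsUnit (g u).det := isUnit_iff_ne_zero.mpr hdet.self_of_nhds
  have hgi := hg.inv hdet.self_of_nhds
  have h := pdMat_mul j hg hgi
  rw [pdMat_congr j (C := fun _ => 1) (hdet.mono fun v hv =>
    Matrix.mul_nonsing_inv _ (isUnit_iff_ne_zero.mpr hv)), pdMat_const] at h
  have h2 : (g u)⁻¹ * (pdMat j g u * (g u)⁻¹ + g u * pdMat j (fun v => (g v)⁻¹) u) = 0 := by
    rw [← h, mul_zero]
  rw [mul_add, ← mul_assoc _ (g u), Matrix.nonsing_inv_mul _ hu, one_mul, hpar] at h2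
  rw [eq_neg_of_add_eq_zero_right h2, add_mul, mul_add, mul_assoc _ (g u),
    Matrix.mul_nonsing_inv _ hu, mul_one, mul_assoc (g u), ← mul_assoc _ (g u),
    Matrix.nonsing_inv_mul _ hu, one_mul]
  abel

/-- The covariant derivative of `B g⁻¹` for a parallel metric `g`. -/
theorem pdMat_mul_inv {g B : EuclideanSpace ℝ (Fin n) → Matrix (Fin n) (Fin n) ℝ} (j : Fin n)
    (hg : MatDifferentiableAt g u) (hB : MatDifferentiableAt B u)
    (hdet : ∀ᶠ v in 𝓝 u, (g v).det ≠ 0)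
    (hpar : pdMat j g u = g u * Γ j + (Γ j)ᵀ * g u) :
    pdMat j (fun v => B v * (g v)⁻¹) u + Γ j * (B u * (g u)⁻¹) + B u * (g u)⁻¹ * (Γ j)ᵀ =
      covEnd Γ j B u * (g u)⁻¹ := by
  rw [pdMat_mul j hB (hg.inv hdet.self_of_nhds), pdMat_inv j hg hdet hpar, covEnd]
  simp only [mul_sub, sub_mul, add_mul, mul_neg, mul_assoc]
  abel

/-- The Christoffel symbols at `u` as connection matrices `(Γ_j)^i_k`. -/
def christoffelMat (g : EuclideanSpace ℝ (Fin n) → Matrix (Fin n) (Fin n) ℝ)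
    (u : EuclideanSpace ℝ (Fin n)) (j : Fin n) : Matrix (Fin n) (Fin n) ℝ :=
  Matrix.of fun i k => christoffel g i j k u

theorem covDivTensor_eq (g T : EuclideanSpace ℝ (Fin n) → Matrix (Fin n) (Fin n) ℝ) (i : Fin n) :
    covDivTensor g T i u = ∑ j, (pdMat j T u + christoffelMat g u j * T u
      + T u * (christoffelMat g u j)ᵀ) i j := by
  simp only [covDivTensor, Matrix.add_apply, sum_add_distrib, Matrix.mul_apply,
    Matrix.transpose_apply, christoffelMat, Matrix.of_apply, pdMat]
  simp only [mul_comm (T u i _)]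

/-- A Codazzi endomorphism field, symmetric with respect to the metric, has divergence-free
weighted Newton tensors. -/
theorem covDivTensor_wNewton {g S : EuclideanSpace ℝ (Fin n) → Matrix (Fin n) (Fin n) ℝ}
    (hg : MatDifferentiableAt g u) (hS : MatDifferentiableAt S u)
    (hpos : ∀ᶠ v in 𝓝 u, (g v).PosDef) (hsymm : ∀ᶠ v in 𝓝 u, (S v)ᵀ = S v)
    (hpar : ∀ j, pdMat j g u = g u * christoffelMat g u j + (christoffelMat g u j)ᵀ * g u)
    (hcod : ∀ i j k, covEnd (christoffelMat g u) j (fun v => (g v)⁻¹ * S v) u i k =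
      covEnd (christoffelMat g u) k (fun v => (g v)⁻¹ * S v) u i j) (μ₀ : ℝ) (r : ℕ) (i : Fin n) :
    covDivTensor g (fun v => wNewton μ₀ ((g v)⁻¹ * S v) r * (g v)⁻¹) i u = 0 := by
  have hdet : ∀ᶠ v in 𝓝 u, (g v).det ≠ 0 := hpos.mono fun v hv => hv.det_pos.ne'
  have hA : MatDifferentiableAt (fun v => (g v)⁻¹ * S v) u :=
    (hg.inv hdet.self_of_nhds).mul hS
  have hN : ∀ᶠ v in 𝓝 u, SatisfiesNewton ((g v)⁻¹ * S v) := by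
    filter_upwards [hpos, hsymm] with v hv hv'
    exact satisfiesNewton_inv_mul hv (by simpa [Matrix.IsHermitian] using hv')
  have hT := hA.wNewton hN μ₀ r
  have hU : ∀ᶠ v in 𝓝 u, (wNewton μ₀ ((g v)⁻¹ * S v) r * (g v)⁻¹)ᵀ =
      wNewton μ₀ ((g v)⁻¹ * S v) r * (g v)⁻¹ := by
    filter_upwards [hpos, hsymm] with v hv hv'
    exact wNewton_mul_inv_symm (by simpa [Matrix.IsHermitian] using hv.isHermitian) hv' μ₀ r
  -- The covariant derivative of a symmetric tensor is symmetric, so the divergence over the second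
  -- index equals that over the first, where `sum_covEnd_wNewton` applies.
  have hsym : ∀ j, (covEnd (christoffelMat g u) j
      (fun v => wNewton μ₀ ((g v)⁻¹ * S v) r) u * (g u)⁻¹)ᵀ = covEnd (christoffelMat g u) j
      (fun v => wNewton μ₀ ((g v)⁻¹ * S v) r) u * (g u)⁻¹ := by
    intro j
    rw [← pdMat_mul_inv j hg hT hdet (hpar j), Matrix.transpose_add, Matrix.transpose_add,
      ← pdMat_transpose, pdMat_congr j hU, Matrix.transpose_mul _ (christoffelMat g u j)ᵀ,
      Matrix.transpose_mul (christoffelMat g u j), hU.self_of_nhds, Matrix.transpose_transpose]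
    abel
  rw [covDivTensor_eq]
  simp only [pdMat_mul_inv _ hg hT hdet (hpar _)]
  calc _ = ∑ j, (covEnd (christoffelMat g u) j
      (fun v => wNewton μ₀ ((g v)⁻¹ * S v) r) u * (g u)⁻¹) j i :=
        sum_congr rfl fun j _ => by rw [← hsym j, Matrix.transpose_apply, hsym j]
    _ = 0 := by
      simp only [Matrix.mul_apply]
      rw [sum_comm]
      simp only [← sum_mul, sum_covEnd_wNewton hA hN hcod, zero_mul, sum_const_zero]

/-- The product rule for the divergence of `T^{ij} f_{,i}`. -/
theorem covDiv_mul_pd {g T : EuclideanSpace ℝ (Fin n) → Matrix (Fin n) (Fin n) ℝ}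
    {f : EuclideanSpace ℝ (Fin n) → ℝ} (hT : MatDifferentiableAt T u) (hsymm : (T u)ᵀ = T u)
    (hf : ∀ i, DifferentiableAt ℝ (pd i f) u) :
    covDiv g (fun v j => ∑ i, T v i j * pd i f v) u =
      ∑ i, covDivTensor g T i u * pd i f u + ∑ i, ∑ j, T u i j * covHess g f i j u := by
  have hpd : ∀ j, pd j (fun v => ∑ i, T v i j * pd i f v) u =
      ∑ i, (pd j (fun v => T v i j) u * pd i f u + T u i j * pd j (pd i f) u) := by
    intro j
    rw [pd_sum j _ fun i _ => (hT i j).fun_mul (hf i)]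
    exact sum_congr rfl fun i _ => pd_mul j (hT i j) (hf i)
  have hs : ∀ i j, T u i j = T u j i := fun i j => by
    conv_lhs => rw [← hsymm, Matrix.transpose_apply]
  simp only [covDiv, covDivTensor, covHess, hpd, add_mul, mul_sub, sum_add_distrib,
    sum_sub_distrib]
  have h1 : ∑ j, ∑ i, pd j (fun v => T v i j) u * pd i f u =
      ∑ i, (∑ j, pd j (fun v => T v i j) u) * pd i f u := by
    rw [sum_comm]
    simp only [sum_mul]
  have h2 : ∑ j, ∑ i, T u i j * pd j (pd i f) u = ∑ i, ∑ j, T u i j * pd i (pd j f) u :=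
    sum_congr rfl fun i _ => sum_congr rfl fun j _ => by rw [hs]
  have h3 : ∑ j, ∑ k, christoffel g j j k u * ∑ i, T u i k * pd i f u =
      ∑ i, (∑ j, ∑ k, christoffel g j j k u * T u i k) * pd i f u := by
    simp only [mul_sum, sum_mul]
    conv_rhs => rw [sum_comm]
    refine sum_congr rfl fun j _ => ?_
    rw [sum_comm]
    exact sum_congr rfl fun i _ => sum_congr rfl fun k _ => by ring
  -- This Christoffel term of the tensor divergence cancels the one in the Hessian.
  have h4 : ∑ i, (∑ j, ∑ k, christoffel g i j k u * T u k j) * pd i f u =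
      ∑ i, ∑ j, T u i j * ∑ k, christoffel g k i j u * pd k f u := by
    simp only [mul_sum, sum_mul]
    rw [sum_comm]
    refine sum_congr rfl fun j _ => ?_
    rw [sum_comm]
    exact sum_congr rfl fun i _ => sum_congr rfl fun k _ => by rw [hs]; ring
  rw [h1, h2, h3, h4]
  ring

end Divergence

end WeightedCurvature

end

/-! ### Gauss, Weingarten and Codazzi equations in coordinates, and passage to charts. -/

noncomputable section

namespace WeightedCurvature

open Matrix Finset Filter Topology

variable {n : ℕ}

/-! ### Higher partial derivatives of smooth functions -/

section Smooth

variable {F : Type*} [NormedAddCommGroup F] [NormedSpace ℝ F]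
  {U : Set (EuclideanSpace ℝ (Fin n))} {u : EuclideanSpace ℝ (Fin n)}

theorem contDiffOn_pd {f : EuclideanSpace ℝ (Fin n) → F} (hf : ContDiffOn ℝ ∞ f U)
    (hU : IsOpen U) (i : Fin n) : ContDiffOn ℝ ∞ (pd i f) U :=
  (hf.fderiv_of_isOpen hU (by simp)).clm_apply contDiffOn_const

theorem differentiableAt_of_contDiffOn {f : EuclideanSpace ℝ (Fin n) → F}
    (hf : ContDiffOn ℝ ∞ f U) (hU : IsOpen U) (hu : u ∈ U) : DifferentiableAt ℝ f u :=
  (hf.contDiffAt (hU.mem_nhds hu)).differentiableAt (by simp)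

theorem pd_comm {f : EuclideanSpace ℝ (Fin n) → F} (hf : ContDiffOn ℝ ∞ f U)
    (hU : IsOpen U) (hu : u ∈ U) (i j : Fin n) : pd i (pd j f) u = pd j (pd i f) u := by
  have hd : DifferentiableAt ℝ (fderiv ℝ f) u :=
    differentiableAt_of_contDiffOn (hf.fderiv_of_isOpen hU (by simp)) hU hu
  have h : ∀ i j : Fin n, pd i (pd j f) u =
      fderiv ℝ (fderiv ℝ f) u (EuclideanSpace.single i 1) (EuclideanSpace.single j 1) := by
    intro i j
    change fderiv ℝ (fun v => fderiv ℝ f v (EuclideanSpace.single j 1)) u _ = _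
    rw [fderiv_clm_apply hd (differentiableAt_const _)]
    simp
  rw [h, h]
  exact ((hf.contDiffAt (hU.mem_nhds hu)).isSymmSndFDerivAt
    (by simpa using WithTop.coe_le_coe.mpr (le_top : (2 : ℕ∞) ≤ ⊤))).eq _ _

theorem pd_inner {m : ℕ} {f h : EuclideanSpace ℝ (Fin n) → EuclideanSpace ℝ (Fin m)}
    (hf : DifferentiableAt ℝ f u) (hh : DifferentiableAt ℝ h u) (i : Fin n) :
    pd i (fun v => inner ℝ (f v) (h v)) u = inner ℝ (pd i f u) (h u) + inner ℝ (f u) (pd i h u) := by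
  rw [pd, fderiv_inner_apply ℝ hf hh, add_comm]
  rfl

theorem pd_coord {m : ℕ} {f : EuclideanSpace ℝ (Fin n) → EuclideanSpace ℝ (Fin m)}
    (hf : DifferentiableAt ℝ f u) (i : Fin n) (a : Fin m) :
    pd i (fun v => f v a) u = pd i f u a := by
  have h := ((EuclideanSpace.proj (𝕜 := ℝ) a).hasFDerivAt.comp u hf.hasFDerivAt).fderiv
  rw [pd, pd]
  change fderiv ℝ ((EuclideanSpace.proj (𝕜 := ℝ) a : EuclideanSpace ℝ (Fin m) →L[ℝ] ℝ) ∘ f) u _ = _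
  rw [h]
  rfl

end Smooth

/-! ### Hypersurfaces in coordinates -/

/-- `φ` parametrizes a hypersurface over the open set `U`, with unit normal `N`. -/
structure IsLocalHypersurface (φ N : EuclideanSpace ℝ (Fin n) → EuclideanSpace ℝ (Fin (n + 1)))
    (U : Set (EuclideanSpace ℝ (Fin n))) : Prop where
  isOpen : IsOpen U
  smooth : ContDiffOn ℝ ∞ φ U
  immersion : ∀ u ∈ U, Function.Injective (fderiv ℝ φ u)
  normal_smooth : ContDiffOn ℝ ∞ N U
  normal_unit : ∀ u ∈ U, ‖N u‖ = 1
  normal_orthogonal : ∀ u ∈ U, ∀ w, inner ℝ (fderiv ℝ φ u w) (N u) = 0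

namespace IsLocalHypersurface

variable {φ N : EuclideanSpace ℝ (Fin n) → EuclideanSpace ℝ (Fin (n + 1))}
  {U : Set (EuclideanSpace ℝ (Fin n))} {u : EuclideanSpace ℝ (Fin n)}

theorem differentiableAt_pd (h : IsLocalHypersurface φ N U) (hu : u ∈ U) (i : Fin n) :
    DifferentiableAt ℝ (pd i φ) u :=
  differentiableAt_of_contDiffOn (contDiffOn_pd h.smooth h.isOpen i) h.isOpen hu

theorem differentiableAt_pd_pd (h : IsLocalHypersurface φ N U) (hu : u ∈ U) (i j : Fin n) :
    DifferentiableAt ℝ (pd i (pd j φ)) u :=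
  differentiableAt_of_contDiffOn
    (contDiffOn_pd (contDiffOn_pd h.smooth h.isOpen j) h.isOpen i) h.isOpen hu

theorem differentiableAt_normal (h : IsLocalHypersurface φ N U) (hu : u ∈ U) :
    DifferentiableAt ℝ N u :=
  differentiableAt_of_contDiffOn h.normal_smooth h.isOpen hu

theorem inner_pd_normal (h : IsLocalHypersurface φ N U) (hu : u ∈ U) (i : Fin n) :
    inner ℝ (pd i φ u) (N u) = 0 :=
  h.normal_orthogonal u hu _

/-- The Weingarten relation, from differentiating `⟨∂_i φ, N⟩ = 0`. -/
theorem inner_pd_pd_normal (h : IsLocalHypersurface φ N U) (hu : u ∈ U) (i j : Fin n) :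
    inner ℝ (pd i φ u) (pd j N u) = -secondForm φ N u j i := by
  have h0 : pd j (fun v => inner ℝ (pd i φ v) (N v)) u = 0 := by
    rw [pd_congr j (h := fun _ => (0 : ℝ)) ?_, pd_const]
    filter_upwards [h.isOpen.mem_nhds hu] with v hv
    exact h.inner_pd_normal hv i
  rw [pd_inner (h.differentiableAt_pd hu i) (h.differentiableAt_normal hu)] at h0
  simp only [secondForm, Matrix.of_apply]
  linarith

theorem inner_normal_pd (h : IsLocalHypersurface φ N U) (hu : u ∈ U) (j : Fin n) :
    inner ℝ (N u) (pd j N u) = 0 := by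
  have h0 : pd j (fun v => inner ℝ (N v) (N v)) u = 0 := by
    rw [pd_congr j (h := fun _ => (1 : ℝ)) ?_, pd_const]
    filter_upwards [h.isOpen.mem_nhds hu] with v hv
    rw [real_inner_self_eq_norm_sq, h.normal_unit v hv, one_pow]
  rw [pd_inner (h.differentiableAt_normal hu) (h.differentiableAt_normal hu),
    real_inner_comm] at h0
  linarith

theorem metric_posDef (h : IsLocalHypersurface φ N U) (hu : u ∈ U) : (metric φ u).PosDef := by
  have hb : LinearIndependent ℝ (fun i : Fin n => (EuclideanSpace.single i (1 : ℝ))) := by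
    simpa only [← EuclideanSpace.basisFun_apply] using
      (EuclideanSpace.basisFun (Fin n) ℝ).orthonormal.linearIndependent
  have hl : LinearIndependent ℝ (fun i => pd i φ u) :=
    hb.map' (fderiv ℝ φ u).toLinearMap (LinearMap.ker_eq_bot.mpr (h.immersion u hu))
  exact Matrix.posDef_gram_of_linearIndependent hl

theorem isUnit_det_metric (h : IsLocalHypersurface φ N U) (hu : u ∈ U) :
    IsUnit (metric φ u).det :=
  isUnit_iff_ne_zero.mpr (h.metric_posDef hu).det_pos.ne'

theorem metric_differentiableAt (h : IsLocalHypersurface φ N U) (hu : u ∈ U) :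
    MatDifferentiableAt (metric φ) u :=
  fun i j => (h.differentiableAt_pd hu i).inner ℝ (h.differentiableAt_pd hu j)

theorem secondForm_differentiableAt (h : IsLocalHypersurface φ N U) (hu : u ∈ U) :
    MatDifferentiableAt (secondForm φ N) u :=
  fun i j => (h.differentiableAt_pd_pd hu i j).inner ℝ (h.differentiableAt_normal hu)

theorem metric_transpose (φ : EuclideanSpace ℝ (Fin n) → EuclideanSpace ℝ (Fin (n + 1)))
    (u : EuclideanSpace ℝ (Fin n)) : (metric φ u)ᵀ = metric φ u := by
  ext i j
  exact real_inner_comm (pd i φ u) (pd j φ u)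

theorem pd_pd_comm (h : IsLocalHypersurface φ N U) (hu : u ∈ U) (i j : Fin n) :
    pd i (pd j φ) u = pd j (pd i φ) u :=
  pd_comm h.smooth h.isOpen hu i j

theorem secondForm_symm (h : IsLocalHypersurface φ N U) (hu : u ∈ U) (i j : Fin n) :
    secondForm φ N u i j = secondForm φ N u j i := by
  simp only [secondForm, Matrix.of_apply, h.pd_pd_comm hu i j]

theorem secondForm_transpose (h : IsLocalHypersurface φ N U) (hu : u ∈ U) :
    (secondForm φ N u)ᵀ = secondForm φ N u := by
  ext i j
  exact h.secondForm_symm hu j i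

/-- The Christoffel symbols of the first kind are `⟨∂_j ∂_k φ, ∂_l φ⟩`. -/
theorem metric_mul_christoffelMat (h : IsLocalHypersurface φ N U) (hu : u ∈ U) (j : Fin n) :
    metric φ u * christoffelMat (metric φ) u j =
      Matrix.of fun l k => inner ℝ (pd j (pd k φ) u) (pd l φ u) := by
  have hc : christoffelMat (metric φ) u j =
      (metric φ u)⁻¹ * Matrix.of fun l k => inner ℝ (pd j (pd k φ) u) (pd l φ u) := by
    ext i k
    simp only [christoffelMat, christoffel, Matrix.of_apply, Matrix.mul_apply, mul_sum]
    refine sum_congr rfl fun l _ => ?_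
    have hd := h.differentiableAt_pd hu
    simp only [metric, Matrix.of_apply]
    rw [pd_inner (hd k) (hd l), pd_inner (hd j) (hd l), pd_inner (hd j) (hd k),
      h.pd_pd_comm hu j l, h.pd_pd_comm hu k l, h.pd_pd_comm hu k j,
      real_inner_comm (pd l (pd j φ) u) (pd k φ u)]
    ring
  rw [hc, Matrix.mul_nonsing_inv_cancel_left _ _ (h.isUnit_det_metric hu)]

theorem christoffel_symm (φ : EuclideanSpace ℝ (Fin n) → EuclideanSpace ℝ (Fin (n + 1)))
    (u : EuclideanSpace ℝ (Fin n)) (i j k : Fin n) :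
    christoffel (metric φ) i j k u = christoffel (metric φ) i k j u := by
  simp only [christoffel, metric, Matrix.of_apply]
  congr 1
  refine sum_congr rfl fun l _ => ?_
  simp only [real_inner_comm (pd j φ _) (pd k φ _)]
  ring

/-- Metric compatibility: the product rule for `⟨∂_i φ, ∂_k φ⟩` gives two terms, which are `g Γ_j`
and its transpose. -/
theorem pdMat_metric (h : IsLocalHypersurface φ N U) (hu : u ∈ U) (j : Fin n) :
    pdMat j (metric φ) u = metric φ u * christoffelMat (metric φ) u j +
      (christoffelMat (metric φ) u j)ᵀ * metric φ u := by
  have ht : (christoffelMat (metric φ) u j)ᵀ * metric φ u =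
      (metric φ u * christoffelMat (metric φ) u j)ᵀ := by
    rw [Matrix.transpose_mul, metric_transpose]
  rw [ht, h.metric_mul_christoffelMat hu]
  ext i k
  simp only [pdMat, metric, Matrix.of_apply, Matrix.add_apply, Matrix.transpose_apply]
  rw [pd_inner (h.differentiableAt_pd hu i) (h.differentiableAt_pd hu k), add_comm,
    real_inner_comm]

/-- The tangent space has dimension `n` by the immersion property, so its orthogonal complement is
the line spanned by `N`. -/
theorem eq_zero_of_inner (h : IsLocalHypersurface φ N U) (hu : u ∈ U)
    {w : EuclideanSpace ℝ (Fin (n + 1))} (ht : ∀ i, inner ℝ w (pd i φ u) = 0)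
    (hn : inner ℝ w (N u) = 0) : w = 0 := by
  set W := LinearMap.range (fderiv ℝ φ u).toLinearMap with hW
  have hfin : Module.finrank ℝ W = n := by
    rw [hW, LinearMap.finrank_range_of_inj (h.immersion u hu)]
    simp
  have hperp : Module.finrank ℝ Wᗮ = 1 := by
    have := W.finrank_add_finrank_orthogonal
    rw [hfin, finrank_euclideanSpace, Fintype.card_fin] at this
    omega
  have hNW : N u ∈ Wᗮ := by
    rintro _ ⟨x, rfl⟩
    exact h.normal_orthogonal u hu x
  have hwW : w ∈ Wᗮ := by
    rintro _ ⟨x, rfl⟩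
    have hx : x = ∑ i, x i • EuclideanSpace.single i (1 : ℝ) := by
      ext k
      simp [Finset.sum_apply, Pi.single_apply]
    rw [hx, real_inner_comm]
    simp only [map_sum, map_smul, inner_sum, inner_smul_right]
    exact sum_eq_zero fun i _ => mul_eq_zero_of_right _ (ht i)
  have hN0 : (⟨N u, hNW⟩ : Wᗮ) ≠ 0 := by
    intro h0
    have h1 := h.normal_unit u hu
    rw [show N u = 0 from congrArg Subtype.val h0] at h1
    simp at h1
  obtain ⟨c, hc⟩ := (finrank_eq_one_iff_of_nonzero' _ hN0).mp hperp ⟨w, hwW⟩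
  have hc' : c • N u = w := congrArg Subtype.val hc
  rw [← hc', inner_smul_left, real_inner_self_eq_norm_sq, h.normal_unit u hu] at hn
  rw [← hc']
  have : c = 0 := by simpa using hn
  rw [this, zero_smul]

/-- The Gauss formula. -/
theorem gauss_formula (h : IsLocalHypersurface φ N U) (hu : u ∈ U) (i j : Fin n) :
    pd i (pd j φ) u = ∑ k, christoffel (metric φ) k i j u • pd k φ u
      + secondForm φ N u i j • N u := by
  rw [← sub_eq_zero]
  refine h.eq_zero_of_inner hu (fun l => ?_) ?_
  · have hl := congrFun (congrFun (h.metric_mul_christoffelMat hu i) l) j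
    simp only [Matrix.mul_apply, Matrix.of_apply, christoffelMat] at hl
    rw [inner_sub_left, ← hl, inner_add_left, sum_inner, inner_smul_left, real_inner_comm (pd l φ u),
      h.inner_pd_normal hu, mul_zero, add_zero, sub_eq_zero]
    refine sum_congr rfl fun k _ => ?_
    rw [inner_smul_left, mul_comm, real_inner_comm]
    rfl
  · rw [inner_sub_left, inner_add_left, sum_inner, inner_smul_left, real_inner_self_eq_norm_sq,
      h.normal_unit u hu, sum_eq_zero fun k _ => ?_]
    · simp [secondForm]
    · rw [inner_smul_left, h.inner_pd_normal hu, mul_zero]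

/-- The derivative of `N` is tangential, so only the tangential part of `∂_l ∂_k φ` pairs with it;
the Weingarten relation evaluates the pairing. -/
theorem pd_secondForm (h : IsLocalHypersurface φ N U) (hu : u ∈ U) (j l k : Fin n) :
    pd j (fun v => secondForm φ N v l k) u = inner ℝ (pd j (pd l (pd k φ)) u) (N u)
      - ∑ m, christoffel (metric φ) m l k u * secondForm φ N u j m := by
  have h1 : inner ℝ (pd l (pd k φ) u) (pd j N u) =
      -∑ m, christoffel (metric φ) m l k u * secondForm φ N u j m := by
    rw [h.gauss_formula hu, inner_add_left, sum_inner, inner_smul_left, h.inner_normal_pd hu,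
      mul_zero, add_zero, ← sum_neg_distrib]
    refine sum_congr rfl fun m _ => ?_
    rw [inner_smul_left, h.inner_pd_pd_normal hu, mul_neg]
    rfl
  simp only [secondForm, Matrix.of_apply] at h1 ⊢
  rw [pd_inner (h.differentiableAt_pd_pd hu l k) (h.differentiableAt_normal hu), h1, sub_eq_add_neg]

theorem pd_pd_pd_swap (h : IsLocalHypersurface φ N U) (hu : u ∈ U) (j l k : Fin n) :
    pd j (pd l (pd k φ)) u = pd k (pd l (pd j φ)) u := by
  have hc : ∀ a b : Fin n, pd a (pd b φ) =ᶠ[𝓝 u] pd b (pd a φ) := fun a b => by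
    filter_upwards [h.isOpen.mem_nhds hu] with v hv
    exact h.pd_pd_comm hv a b
  rw [pd_congr j (hc l k), pd_comm (contDiffOn_pd h.smooth h.isOpen l) h.isOpen hu,
    pd_congr k (hc j l)]

/-- The Codazzi equation for the shape operator. -/
theorem codazzi (h : IsLocalHypersurface φ N U) (hu : u ∈ U) (i j k : Fin n) :
    covEnd (christoffelMat (metric φ) u) j (shape φ N) u i k =
      covEnd (christoffelMat (metric φ) u) k (shape φ N) u i j := by
  have hdet : ∀ᶠ v in 𝓝 u, (metric φ v).det ≠ 0 := by
    filter_upwards [h.isOpen.mem_nhds hu] with v hv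
    exact (h.metric_posDef hv).det_pos.ne'
  -- As `g` is parallel, the index can be lowered, which reduces the claim to the symmetry of
  -- `A_{lk,j}` in `j` and `k`.
  have hcov : ∀ j, covEnd (christoffelMat (metric φ) u) j (shape φ N) u = (metric φ u)⁻¹ *
      (pdMat j (secondForm φ N) u - (christoffelMat (metric φ) u j)ᵀ * secondForm φ N u
        - secondForm φ N u * christoffelMat (metric φ) u j) := by
    intro j
    have hs : shape φ N = fun v => (metric φ v)⁻¹ * secondForm φ N v := rfl
    rw [covEnd, hs, pdMat_mul j ((h.metric_differentiableAt hu).inv hdet.self_of_nhds)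
      (h.secondForm_differentiableAt hu),
      pdMat_inv j (h.metric_differentiableAt hu) hdet (h.pdMat_metric hu j)]
    simp only [mul_sub, sub_mul, neg_mul, mul_assoc]
    abel
  rw [hcov, hcov, Matrix.mul_apply, Matrix.mul_apply]
  refine sum_congr rfl fun l _ => congrArg _ ?_
  -- Exchanging `j` and `k` fixes the third-derivative term and the `Γ^m_{jk}` term, and swaps the
  -- two remaining Christoffel sums.
  simp only [Matrix.sub_apply, Matrix.mul_apply, pdMat, Matrix.of_apply, Matrix.transpose_apply,
    christoffelMat, h.pd_secondForm hu, h.pd_pd_pd_swap hu j l k, christoffel_symm φ u _ j k,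
    christoffel_symm φ u _ l, h.secondForm_symm hu j, h.secondForm_symm hu k,
    mul_comm (christoffel _ _ _ _ _)]
  ring

/-- The Christoffel terms cancel the tangential part of the Gauss formula. -/
theorem covHess_coord (h : IsLocalHypersurface φ N U) (hu : u ∈ U) (i j : Fin n)
    (a : Fin (n + 1)) :
    covHess (metric φ) (fun v => φ v a) i j u = secondForm φ N u i j * N u a := by
  have h1 : pd j (fun v => φ v a) =ᶠ[𝓝 u] fun v => pd j φ v a := by
    filter_upwards [h.isOpen.mem_nhds hu] with v hv
    exact pd_coord (differentiableAt_of_contDiffOn h.smooth h.isOpen hv) j a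
  rw [covHess, pd_congr i h1, pd_coord (h.differentiableAt_pd hu j), h.gauss_formula hu]
  simp [pd_coord (differentiableAt_of_contDiffOn h.smooth h.isOpen hu)]

theorem satisfiesNewton_shape (h : IsLocalHypersurface φ N U) (hu : u ∈ U) :
    SatisfiesNewton (shape φ N u) :=
  satisfiesNewton_inv_mul (h.metric_posDef hu)
    (by simpa [Matrix.IsHermitian] using h.secondForm_transpose hu)

theorem sum_newtonUp_mul_covHess (h : IsLocalHypersurface φ N U) (hu : u ∈ U) (μ₀ : ℝ) (r : ℕ)
    (a : Fin (n + 1)) :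
    ∑ i, ∑ j, newtonUp μ₀ r φ N u i j * covHess (metric φ) (fun v => φ v a) i j u =
      (((r : ℝ) + 1) * wsigma μ₀ (shape φ N u) (r + 1) - μ₀ * wsigma μ₀ (shape φ N u) r)
        * N u a := by
  rw [← (h.satisfiesNewton_shape hu).trace_wNewton_mul_self]
  have : wNewton μ₀ (shape φ N u) r * shape φ N u = newtonUp μ₀ r φ N u * secondForm φ N u := by
    rw [newtonUp, mul_assoc]
    rfl
  rw [this, Matrix.trace, sum_mul]
  refine sum_congr rfl fun i _ => ?_
  rw [Matrix.diag_apply, Matrix.mul_apply, sum_mul]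
  refine sum_congr rfl fun j _ => ?_
  rw [h.covHess_coord hu, h.secondForm_symm hu]
  ring

theorem covDivTensor_newtonUp (h : IsLocalHypersurface φ N U) (hu : u ∈ U) (μ₀ : ℝ) (r : ℕ)
    (i : Fin n) : covDivTensor (metric φ) (newtonUp μ₀ r φ N) i u = 0 :=
  covDivTensor_wNewton (h.metric_differentiableAt hu) (h.secondForm_differentiableAt hu)
    (by filter_upwards [h.isOpen.mem_nhds hu] with v hv using h.metric_posDef hv)
    (by filter_upwards [h.isOpen.mem_nhds hu] with v hv using h.secondForm_transpose hv)
    (h.pdMat_metric hu) (h.codazzi hu) μ₀ r i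

theorem newtonUp_differentiableAt (h : IsLocalHypersurface φ N U) (hu : u ∈ U) (μ₀ : ℝ) (r : ℕ) :
    MatDifferentiableAt (newtonUp μ₀ r φ N) u := by
  have hgi := (h.metric_differentiableAt hu).inv (h.metric_posDef hu).det_pos.ne'
  have hA : MatDifferentiableAt (shape φ N) u := hgi.mul (h.secondForm_differentiableAt hu)
  refine (hA.wNewton ?_ μ₀ r).mul hgi
  filter_upwards [h.isOpen.mem_nhds hu] with v hv using h.satisfiesNewton_shape hv

theorem covDiv_newtonUp (h : IsLocalHypersurface φ N U) (hu : u ∈ U) (μ₀ : ℝ) (r : ℕ)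
    (a : Fin (n + 1)) :
    covDiv (metric φ) (fun v j => ∑ i, newtonUp μ₀ r φ N v i j * pd i (fun v => φ v a) v) u =
      ∑ i, ∑ j, newtonUp μ₀ r φ N u i j * covHess (metric φ) (fun v => φ v a) i j u := by
  rw [covDiv_mul_pd (h.newtonUp_differentiableAt hu μ₀ r)
    (wNewton_mul_inv_symm (metric_transpose φ u) (h.secondForm_transpose hu) μ₀ r) fun i => ?_]
  · simp only [h.covDivTensor_newtonUp hu, zero_mul, sum_const_zero, zero_add]
  · have hs : ContDiffOn ℝ ∞ (fun v => φ v a) U :=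
      (EuclideanSpace.proj (𝕜 := ℝ) a).contDiff.comp_contDiffOn h.smooth
    exact differentiableAt_of_contDiffOn (contDiffOn_pd hs h.isOpen i) h.isOpen hu

theorem forall_mul_normal_eq_zero_iff (h : IsLocalHypersurface φ N U) (hu : u ∈ U) (c : ℝ) :
    (∀ a, c * N u a = 0) ↔ c = 0 := by
  refine ⟨fun hc => ?_, fun hc a => by rw [hc, zero_mul]⟩
  have h0 : c • N u = 0 := by
    ext a
    simpa using hc a
  have h1 := congrArg norm h0
  rw [norm_smul, h.normal_unit u hu] at h1
  simpa using h1

end IsLocalHypersurface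

/-! ### Hypersurfaces in the charts of a manifold -/

theorem IsHypersurface.isLocalHypersurface {M : Type*} [TopologicalSpace M]
    [ChartedSpace (EuclideanSpace ℝ (Fin n)) M] [IsManifold (𝓡 n) ∞ M]
    {ψ ν : M → EuclideanSpace ℝ (Fin (n + 1))} (hψ : IsHypersurface ψ ν)
    {e : OpenPartialHomeomorph M (EuclideanSpace ℝ (Fin n))}
    (he : e ∈ IsManifold.maximalAtlas (𝓡 n) ∞ M) :
    IsLocalHypersurface (ψ ∘ e.symm) (ν ∘ e.symm) e.target := by
  have hsymm : ContMDiffOn (𝓡 n) (𝓡 n) ∞ e.symm e.target :=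
    contMDiffOn_symm_of_mem_maximalAtlas he
  have hmd : e.MDifferentiable (𝓡 n) (𝓡 n) :=
    ⟨(contMDiffOn_of_mem_maximalAtlas he).mdifferentiableOn (by simp),
      hsymm.mdifferentiableOn (by simp)⟩
  have hfd : ∀ u ∈ e.target, ∀ w, fderiv ℝ (ψ ∘ e.symm) u w =
      mfderiv (𝓡 n) (𝓡 (n + 1)) ψ (e.symm u) (mfderiv (𝓡 n) (𝓡 n) e.symm u w) := by
    intro u hu w
    rw [← mfderiv_eq_fderiv, mfderiv_comp u (hψ.smooth.mdifferentiable (by simp) _)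
      (hmd.mdifferentiableAt_symm hu)]
    rfl
  refine ⟨e.open_target, ?_, fun u hu => ?_, ?_, fun u _ => hψ.normal_unit _, fun u hu w => ?_⟩
  · exact contMDiffOn_iff_contDiffOn.mp (hψ.smooth.comp_contMDiffOn hsymm)
  -- The inverse chart is a diffeomorphism onto its image, so composing with it preserves
  -- immersions.
  · have hinj : Function.Injective (mfderiv (𝓡 n) (𝓡 n) e.symm u) :=
      hmd.symm.mfderiv_injective hu
    intro w w' hw
    rw [hfd u hu, hfd u hu] at hw
    exact hinj (hψ.immersion _ hw)
  · exact contMDiffOn_iff_contDiffOn.mp (hψ.normal_smooth.comp_contMDiffOn hsymm)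
  · rw [hfd u hu]
    exact hψ.normal_orthogonal _ _

end WeightedCurvature

end

theorem mainTheorem3 {n : ℕ} {M : Type*} [TopologicalSpace M]
    [ChartedSpace (EuclideanSpace ℝ (Fin n)) M] [IsManifold (𝓡 n) ∞ M]
    (ψ ν : M → EuclideanSpace ℝ (Fin (n + 1))) (hψ : WeightedCurvature.IsHypersurface ψ ν)
    (μ₀ : ℝ) (r : ℕ) :
    (WeightedCurvature.IsSigmaMinimal μ₀ r ψ ν ↔
      ∀ a, WeightedCurvature.SolvesNewtonPDE μ₀ r ψ ν (fun p => ψ p a)) ∧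
    (WeightedCurvature.IsSigmaMinimal μ₀ r ψ ν ↔
      ∀ a, WeightedCurvature.SolvesNewtonDivPDE μ₀ r ψ ν (fun p => ψ p a)) ∧
    WeightedCurvature.NewtonDivFree μ₀ r ψ ν := by
  have hPDE : WeightedCurvature.IsSigmaMinimal μ₀ r ψ ν ↔
      ∀ a, WeightedCurvature.SolvesNewtonPDE μ₀ r ψ ν (fun p => ψ p a) := by
    constructor
    · intro h a e he u hu
      have hl := hψ.isLocalHypersurface he
      exact (hl.sum_newtonUp_mul_covHess hu μ₀ r a).trans (by rw [h e he u hu, zero_mul])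
    · intro h e he u hu
      have hl := hψ.isLocalHypersurface he
      exact (hl.forall_mul_normal_eq_zero_iff hu _).mp fun a =>
        (hl.sum_newtonUp_mul_covHess hu μ₀ r a).symm.trans (h a e he u hu)
  have hDiv : ∀ a, WeightedCurvature.SolvesNewtonDivPDE μ₀ r ψ ν (fun p => ψ p a) ↔
      WeightedCurvature.SolvesNewtonPDE μ₀ r ψ ν (fun p => ψ p a) := fun a =>
    forall₄_congr fun e he u hu => Eq.congr
      ((hψ.isLocalHypersurface he).covDiv_newtonUp hu μ₀ r a) rfl
  exact ⟨hPDE, hPDE.trans (forall_congr' fun a => (hDiv a).symm), fun e he u hu i =>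
    (hψ.isLocalHypersurface he).covDivTensor_newtonUp hu μ₀ r i⟩
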